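/- A smooth manifold is a second-countable Hausdorff topological space $M$ together with a smooth atlas: a family of charts, each a homeomorphism $\phi_U : U \to \phi_U(U)$ from an open set $U \subseteq M$ onto an open subset of some $\mathbb{R}^{n(U)}$, such that the sets $U$ cover $M$ and all transition maps $\phi_V \circ \phi_U^{-1}$ are $C^\infty$ on their domain of definition. The dimension $n(U)$ is finite but may vary with the chart, and need not be bounded on $M$. A map $f : M \to N$ between smooth manifolds is smooth if it is continuous and $\psi_V \circ f \circ \phi_U^{-1}$ is $C^\infty$ on its domain of definition for all charts $\phi_U$ of $M$ and $\psi_V$ of $N$. Let $\mathbf{Man}$ be the category of smooth manifolds and smooth maps; it has finite products, given by the one-point manifold and the product manifolds. **Theorem.** The category $\mathbf{Man}$ is not cartesian closed; that is, it is not the case that for every smooth manifold $M$ the functor $M \times - : \mathbf{Man} \to \mathbf{Man}$ has a right adjoint. -/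

import Mathlib

open CategoryTheory CategoryTheory.Limits
open scoped ContDiff

/-- A chart on `X`: a homeomorphism from an open subset of `X` onto an open subset of some `ℝⁿ`.
The dimension `n` is part of the data, so that it may vary from chart to chart. -/
abbrev EuclideanChart (X : Type) [TopologicalSpace X] : Type :=
  Σ n : ℕ, OpenPartialHomeomorph X (EuclideanSpace ℝ (Fin n))

/-- `f`, read in the charts `c` and `d`, is smooth on its domain of definition. -/
def SmoothInCharts {X Y : Type} [TopologicalSpace X] [TopologicalSpace Y]
    (c : EuclideanChart X) (d : EuclideanChart Y) (f : X → Y) : Prop :=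
  ContDiffOn ℝ ∞ (fun v => d.2 (f (c.2.symm v))) {v | v ∈ c.2.target ∧ f (c.2.symm v) ∈ d.2.source}

/-- Smooth manifolds: second-countable Hausdorff spaces with a smooth atlas, whose charts may have
different finite dimensions. -/
structure Man : Type 1 where
  /-- the points of the manifold -/
  carrier : Type
  [top : TopologicalSpace carrier]
  [t2 : T2Space carrier]
  [secondCountable : SecondCountableTopology carrier]
  /-- the smooth atlas -/
  atlas : Set (EuclideanChart carrier)
  cover : ∀ x : carrier, ∃ c ∈ atlas, x ∈ c.2.source
  compatible : ∀ c ∈ atlas, ∀ d ∈ atlas, SmoothInCharts c d id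

namespace Man

attribute [instance] Man.top Man.t2 Man.secondCountable

instance : CoeSort Man Type where
  coe M := M.carrier

/-- A function between manifolds is smooth if it is continuous and smooth in all charts. -/
def IsSmooth {M N : Man} (f : M → N) : Prop :=
  Continuous f ∧ ∀ c ∈ M.atlas, ∀ d ∈ N.atlas, SmoothInCharts c d f

theorem smoothInCharts_of_contDiffAt {X Y : Type} [TopologicalSpace X] [TopologicalSpace Y]
    {c : EuclideanChart X} {d : EuclideanChart Y} {f : X → Y}
    (h : ∀ x ∈ c.2.source, f x ∈ d.2.source →
      ContDiffAt ℝ ∞ (fun v => d.2 (f (c.2.symm v))) (c.2 x)) : SmoothInCharts c d f := by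
  rintro v ⟨hv, hfv⟩
  have := h (c.2.symm v) (c.2.map_target hv) hfv
  rw [c.2.right_inv hv] at this
  exact this.contDiffWithinAt

theorem contDiffAt_of_smoothInCharts {X Y : Type} [TopologicalSpace X] [TopologicalSpace Y]
    {c : EuclideanChart X} {d : EuclideanChart Y} {f : X → Y} (hf : Continuous f)
    (h : SmoothInCharts c d f) {x : X} (hx : x ∈ c.2.source) (hfx : f x ∈ d.2.source) :
    ContDiffAt ℝ ∞ (fun v => d.2 (f (c.2.symm v))) (c.2 x) := by
  refine ContDiffOn.contDiffAt h (IsOpen.mem_nhds ?_ ⟨c.2.map_source hx, ?_⟩)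
  · exact c.2.isOpen_inter_preimage_symm (d.2.open_source.preimage hf)
  · rwa [c.2.left_inv hx]

theorem isSmooth_id (M : Man) : IsSmooth (fun x : M => x) :=
  ⟨continuous_id, M.compatible⟩

theorem IsSmooth.comp {M N P : Man} {g : N → P} {f : M → N} (hg : IsSmooth g) (hf : IsSmooth f) :
    IsSmooth (fun x => g (f x)) := by
  refine ⟨hg.1.comp hf.1, fun c hc e he => smoothInCharts_of_contDiffAt fun x hx hgx => ?_⟩
  obtain ⟨d, hd, hfx⟩ := N.cover (f x)
  have h1 := contDiffAt_of_smoothInCharts hf.1 (hf.2 c hc d hd) hx hfx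
  have h2 := contDiffAt_of_smoothInCharts hg.1 (hg.2 d hd e he) hfx hgx
  have h3 : ContDiffAt ℝ ∞ (fun w => e.2 (g (d.2.symm w))) (d.2 (f (c.2.symm (c.2 x)))) := by
    rwa [c.2.left_inv hx]
  refine (ContDiffAt.comp (c.2 x) h3 h1).congr_of_eventuallyEq ?_
  have hopen : IsOpen (c.2.target ∩ c.2.symm ⁻¹' (f ⁻¹' d.2.source)) :=
    c.2.isOpen_inter_preimage_symm (d.2.open_source.preimage hf.1)
  have hmem : c.2 x ∈ c.2.target ∩ c.2.symm ⁻¹' (f ⁻¹' d.2.source) :=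
    ⟨c.2.map_source hx, by simpa [c.2.left_inv hx] using hfx⟩
  filter_upwards [hopen.mem_nhds hmem] with v hv
  have hv' : f (c.2.symm v) ∈ d.2.source := hv.2
  simp [d.2.left_inv hv']

/-- The morphisms of `Man`: smooth functions. -/
@[ext]
structure Hom (M N : Man) : Type where
  /-- the underlying function -/
  toFun : M → N
  smooth : IsSmooth toFun

/-- The category of smooth manifolds and smooth functions. -/
instance : Category Man where
  Hom := Hom
  id M := ⟨fun x => x, isSmooth_id M⟩
  comp f g := ⟨fun x => g.toFun (f.toFun x), g.smooth.comp f.smooth⟩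

@[ext]
theorem hom_ext {M N : Man} {f g : M ⟶ N} (h : ∀ x, f.toFun x = g.toFun x) : f = g :=
  Hom.ext (funext h)

/-- The one-point manifold, of dimension `0`. -/
def point : Man where
  carrier := Unit
  atlas := {⟨0, (Homeomorph.homeomorphOfUnique Unit
    (EuclideanSpace ℝ (Fin 0))).toOpenPartialHomeomorph⟩}
  cover _ := ⟨_, rfl, Set.mem_univ _⟩
  compatible := by
    rintro c rfl d rfl
    exact contDiff_of_subsingleton.contDiffOn

theorem isSmooth_toPoint (M : Man) : IsSmooth (M := M) (N := point) (fun _ => ()) := by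
  refine ⟨continuous_const, ?_⟩
  rintro c - d rfl
  exact contDiff_const.contDiffOn

/-- The product of a chart onto an open subset of `ℝᵐ` and a chart onto an open subset of `ℝⁿ`:
a chart onto an open subset of `ℝᵐ⁺ⁿ = ℝᵐ × ℝⁿ`. -/
noncomputable def prodChart {X Y : Type} [TopologicalSpace X] [TopologicalSpace Y]
    (c : EuclideanChart X) (d : EuclideanChart Y) : EuclideanChart (X × Y) :=
  ⟨c.1 + d.1, (c.2.prod d.2).transHomeomorph
    (EuclideanSpace.finAddEquivProd (𝕜 := ℝ) (n := c.1) (m := d.1)).symm.toHomeomorph⟩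

theorem smoothInCharts_fst {X Y Z : Type} [TopologicalSpace X] [TopologicalSpace Y]
    [TopologicalSpace Z] {c : EuclideanChart X} {d : EuclideanChart Y} {e : EuclideanChart Z}
    {f : X → Z} (h : SmoothInCharts c e f) :
    SmoothInCharts (prodChart c d) e (fun p => f p.1) := by
  let L := EuclideanSpace.finAddEquivProd (𝕜 := ℝ) (n := c.1) (m := d.1)
  have hL : ContDiff ℝ ∞ (fun v => (L v).1) := contDiff_fst.comp L.contDiff
  unfold SmoothInCharts at h
  exact h.comp hL.contDiffOn fun v hv => ⟨hv.1.1, hv.2⟩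

theorem smoothInCharts_snd {X Y Z : Type} [TopologicalSpace X] [TopologicalSpace Y]
    [TopologicalSpace Z] {c : EuclideanChart X} {d : EuclideanChart Y} {e : EuclideanChart Z}
    {f : Y → Z} (h : SmoothInCharts d e f) :
    SmoothInCharts (prodChart c d) e (fun p => f p.2) := by
  let L := EuclideanSpace.finAddEquivProd (𝕜 := ℝ) (n := c.1) (m := d.1)
  have hL : ContDiff ℝ ∞ (fun v => (L v).2) := contDiff_snd.comp L.contDiff
  unfold SmoothInCharts at h
  exact h.comp hL.contDiffOn fun v hv => ⟨hv.1.2, hv.2⟩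

theorem smoothInCharts_prodMk {X Y Z : Type} [TopologicalSpace X] [TopologicalSpace Y]
    [TopologicalSpace Z] {c : EuclideanChart X} {d : EuclideanChart Y} {e : EuclideanChart Z}
    {f : Z → X} {g : Z → Y} (hf : SmoothInCharts e c f) (hg : SmoothInCharts e d g) :
    SmoothInCharts e (prodChart c d) (fun z => (f z, g z)) := by
  let L := EuclideanSpace.finAddEquivProd (𝕜 := ℝ) (n := c.1) (m := d.1)
  exact L.symm.contDiff.comp_contDiffOn
    (ContDiffOn.prodMk (ContDiffOn.mono hf fun v hv => ⟨hv.1, hv.2.1⟩)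
      (ContDiffOn.mono hg fun v hv => ⟨hv.1, hv.2.2⟩))

/-- The product of two manifolds, whose atlas consists of the products of charts. -/
noncomputable def prod (M N : Man) : Man where
  carrier := M × N
  atlas := {e | ∃ c ∈ M.atlas, ∃ d ∈ N.atlas, e = prodChart c d}
  cover p := by
    obtain ⟨c, hc, hpc⟩ := M.cover p.1
    obtain ⟨d, hd, hpd⟩ := N.cover p.2
    exact ⟨_, ⟨c, hc, d, hd, rfl⟩, hpc, hpd⟩
  compatible := by
    rintro _ ⟨c, hc, d, hd, rfl⟩ _ ⟨c', hc', d', hd', rfl⟩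
    exact smoothInCharts_prodMk (smoothInCharts_fst (M.compatible c hc c' hc'))
      (smoothInCharts_snd (N.compatible d hd d' hd'))

theorem isSmooth_fst (M N : Man) : IsSmooth (M := prod M N) (N := M) (fun p => p.1) := by
  refine ⟨continuous_fst, ?_⟩
  rintro _ ⟨c, hc, d, hd, rfl⟩ c' hc'
  exact smoothInCharts_fst (M.compatible c hc c' hc')

theorem isSmooth_snd (M N : Man) : IsSmooth (M := prod M N) (N := N) (fun p => p.2) := by
  refine ⟨continuous_snd, ?_⟩
  rintro _ ⟨c, hc, d, hd, rfl⟩ d' hd'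
  exact smoothInCharts_snd (N.compatible d hd d' hd')

theorem IsSmooth.prodMk {P M N : Man} {f : P → M} {g : P → N} (hf : IsSmooth f)
    (hg : IsSmooth g) : IsSmooth (N := prod M N) (fun x => (f x, g x)) := by
  refine ⟨hf.1.prodMk hg.1, ?_⟩
  rintro e he _ ⟨c, hc, d, hd, rfl⟩
  exact smoothInCharts_prodMk (hf.2 e he c hc) (hg.2 e he d hd)

/-- The one-point manifold is terminal. -/
def isTerminalPoint : IsTerminal point :=
  IsTerminal.ofUniqueHom (fun M => (⟨fun _ => (), isSmooth_toPoint M⟩ : Hom M point))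
    fun _ _ => hom_ext fun _ => rfl

/-- The product manifold with its two projections. -/
noncomputable def prodFan (M N : Man) : BinaryFan M N :=
  BinaryFan.mk (P := prod M N) (⟨fun p => p.1, isSmooth_fst M N⟩ : Hom (prod M N) M)
    (⟨fun p => p.2, isSmooth_snd M N⟩ : Hom (prod M N) N)

/-- The product manifold is the categorical product. -/
noncomputable def isLimitProdFan (M N : Man) : IsLimit (prodFan M N) :=
  BinaryFan.isLimitMk
    (fun s => (⟨fun x => (s.fst.toFun x, s.snd.toFun x), s.fst.smooth.prodMk s.snd.smooth⟩ :
      Hom s.pt (prod M N)))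
    (fun _ => rfl) (fun _ => rfl)
    (fun s _ h₁ h₂ => hom_ext fun x => Prod.ext
      (congrArg (fun k : Hom s.pt M => k.toFun x) h₁)
      (congrArg (fun k : Hom s.pt N => k.toFun x) h₂))

/-- `Man` has finite products: the one-point manifold and the product manifolds. -/
noncomputable instance : CartesianMonoidalCategory Man :=
  CartesianMonoidalCategory.ofChosenFiniteProducts ⟨_, isTerminalPoint⟩
    fun M N => ⟨_, isLimitProdFan M N⟩

end Man

namespace Man

/-! Suppose the exponential `E` of `ℝ` by `ℝ` exists. Polynomials with `k` coefficients form a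
smooth family of functions `ℝ → ℝ`, classified by a smooth map `g : ℝᵏ → E`. Evaluation at any `t`
is smooth on `E` and turns `g` into a map linear in the coefficients, so a vector killed by the
derivative of `g` at `0` is a polynomial vanishing at every `t`, hence zero. Thus charts of `E`
around `g 0` have dimension at least `k` (`le_dim_of_comp_eq_polyFamily`). As dimensions may vary
over `E`, it is essential that `g 0` is the same point for all `k`, namely the one naming the zero
function; a chart there would have infinite dimension. -/

/-- Euclidean space as a manifold with a single chart. -/
def euclidean (n : ℕ) : Man where
  carrier := EuclideanSpace ℝ (Fin n)
  atlas := {⟨n, OpenPartialHomeomorph.refl _⟩}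
  cover _ := ⟨_, rfl, Set.mem_univ _⟩
  compatible := by
    rintro c rfl d rfl
    exact contDiff_id.contDiffOn

theorem isSmooth_const {M N : Man} (y : N) : IsSmooth (M := M) (fun _ => y) :=
  ⟨continuous_const, fun _ _ _ _ => contDiff_const.contDiffOn⟩

/-- A smooth function on `ℝᵐ × ℝⁿ` defines a morphism out of the product manifold. -/
def homOfContDiff {m n p : ℕ}
    (f : EuclideanSpace ℝ (Fin m) × EuclideanSpace ℝ (Fin n) → EuclideanSpace ℝ (Fin p))
    (hf : ContDiff ℝ ∞ f) : Hom (prod (euclidean m) (euclidean n)) (euclidean p) where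
  toFun := f
  smooth := by
    refine ⟨hf.continuous, ?_⟩
    rintro _ ⟨c, rfl, d, rfl, rfl⟩ e rfl
    exact (hf.comp (EuclideanSpace.finAddEquivProd (𝕜 := ℝ) (n := m) (m := n)).contDiff).contDiffOn

/-- The generic polynomial with `k` coefficients `a`, evaluated at `t`. -/
noncomputable def polyFamily (k : ℕ) (p : EuclideanSpace ℝ (Fin 1) × EuclideanSpace ℝ (Fin k)) :
    EuclideanSpace ℝ (Fin 1) :=
  (∑ i : Fin k, p.2 i * p.1 0 ^ (i : ℕ)) • EuclideanSpace.single 0 1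

theorem contDiff_polyFamily (k : ℕ) : ContDiff ℝ ∞ (polyFamily k) := by
  unfold polyFamily
  fun_prop

/-- A real polynomial is determined by its values, since `ℝ` is infinite. -/
theorem eq_zero_of_polyFamily_eq_zero {k : ℕ} {v : EuclideanSpace ℝ (Fin k)}
    (h : ∀ t, polyFamily k (t, v) = 0) : v = 0 := by
  have hp : ∑ i : Fin k, Polynomial.monomial (i : ℕ) (v i) = 0 := by
    refine Polynomial.funext fun r => ?_
    have := congrArg (fun w : EuclideanSpace ℝ (Fin 1) => w 0) (h (EuclideanSpace.single 0 r))
    simpa [polyFamily, Polynomial.eval_finsetSum] using this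
  ext j
  have := congrArg (fun p => Polynomial.coeff p (j : ℕ)) hp
  simpa [Polynomial.finsetSum_coeff, Polynomial.coeff_monomial, Fin.val_inj] using this

/-- For fixed `t` the value is linear in the coefficients, so it is its own derivative. -/
theorem hasFDerivAt_polyFamily (k : ℕ) (t : EuclideanSpace ℝ (Fin 1)) :
    ∃ L : EuclideanSpace ℝ (Fin k) →L[ℝ] EuclideanSpace ℝ (Fin 1),
      (∀ v, L v = polyFamily k (t, v)) ∧
        HasFDerivAt (fun a => polyFamily k (t, a)) L 0 := by
  let L : EuclideanSpace ℝ (Fin k) →ₗ[ℝ] EuclideanSpace ℝ (Fin 1) :=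
    { toFun := fun a => polyFamily k (t, a)
      map_add' := fun a b => by simp [polyFamily, add_mul, Finset.sum_add_distrib, add_smul]
      map_smul' := fun r a => by
        simp [polyFamily, mul_assoc, ← Finset.mul_sum, smul_smul] }
  exact ⟨L.toContinuousLinearMap, fun _ => rfl, L.toContinuousLinearMap.hasFDerivAt⟩

/-- If smooth functions `h t` on `E` pull back along `g : ℝᵏ → E` to evaluation of the generic
polynomial, then `E` has dimension at least `k` at `g 0`. -/
theorem le_dim_of_comp_eq_polyFamily {k : ℕ} {E : Man} {g : EuclideanSpace ℝ (Fin k) → E}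
    (hg : IsSmooth (M := euclidean k) g) {h : EuclideanSpace ℝ (Fin 1) → E → EuclideanSpace ℝ (Fin 1)}
    (hh : ∀ t, IsSmooth (N := euclidean 1) (h t))
    (hgh : ∀ t a, h t (g a) = polyFamily k (t, a)) {c : EuclideanChart E} (hc : c ∈ E.atlas)
    (hgc : g 0 ∈ c.2.source) : k ≤ c.1 := by
  by_contra! hlt
  have h1 : ContDiffAt ℝ ∞ (fun a : EuclideanSpace ℝ (Fin k) => c.2 (g a)) 0 :=
    contDiffAt_of_smoothInCharts (x := (0 : EuclideanSpace ℝ (Fin k))) hg.1 (hg.2 _ rfl c hc)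
      (Set.mem_univ _) hgc
  have hd1 := (h1.differentiableAt (by simp)).hasFDerivAt
  obtain ⟨v, hv, hv0⟩ := Submodule.exists_mem_ne_zero_of_ne_bot
    (LinearMap.ker_ne_bot_of_finrank_lt
      (f := (fderiv ℝ (fun a : EuclideanSpace ℝ (Fin k) => c.2 (g a)) 0).toLinearMap)
      (by simpa using hlt))
  refine hv0 (eq_zero_of_polyFamily_eq_zero fun t => ?_)
  have h2 : ContDiffAt ℝ ∞ (fun w => h t (c.2.symm w))
      (c.2 (g 0)) :=
    contDiffAt_of_smoothInCharts (hh t).1 ((hh t).2 c hc _ rfl) hgc (Set.mem_univ _)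
  have hd2 := (h2.differentiableAt (by simp)).hasFDerivAt
  obtain ⟨L, hL, hdL⟩ := hasFDerivAt_polyFamily k t
  -- Near `0` the map `g` stays in the chart, so evaluation factors through its coordinates and the
  -- chain rule applies.
  have hev : (fun a => polyFamily k (t, a)) =ᶠ[nhds 0]
      fun a => h t (c.2.symm (c.2 (g a))) := by
    filter_upwards [(c.2.open_source.preimage hg.1).mem_nhds hgc] with a ha
    exact (hgh t a).symm.trans (congrArg (h t) (c.2.left_inv ha).symm)
  have hd := HasFDerivAt.comp (0 : EuclideanSpace ℝ (Fin k)) hd2 hd1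
  have huniq := hdL.unique (hd.congr_of_eventuallyEq hev)
  rw [← hL, huniq]
  have hv' : fderiv ℝ (fun a : EuclideanSpace ℝ (Fin k) => c.2 (g a)) 0 v = 0 := hv
  simp [hv']

open MonoidalCategory

/-- The generic polynomial as a morphism. -/
noncomputable def polyHom (k : ℕ) : euclidean 1 ⊗ euclidean k ⟶ euclidean 1 :=
  homOfContDiff (polyFamily k) (contDiff_polyFamily k)

/-- The origin of `ℝᵏ` as a morphism. -/
def zeroHom (k : ℕ) : point ⟶ euclidean k :=
  (⟨fun _ => (0 : EuclideanSpace ℝ (Fin k)), isSmooth_const _⟩ : Hom point (euclidean k))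

/-- The right-hand side does not involve `k`; this makes the base point in the exponential
independent of `k`. -/
theorem whiskerLeft_zeroHom_comp_polyHom (k : ℕ) :
    euclidean 1 ◁ zeroHom k ≫ polyHom k =
      (⟨fun _ => (0 : EuclideanSpace ℝ (Fin 1)), isSmooth_const _⟩ :
        Hom (prod (euclidean 1) point) (euclidean 1)) := by
  refine hom_ext fun p => ?_
  change polyFamily k (p.1, 0) = 0
  simp [polyFamily]

end Man

open Man MonoidalCategory in
/-- The category of smooth manifolds is not cartesian closed: it has finite products, but not every
functor `M × -` has a right adjoint. -/
theorem mainTheorem8 : ¬ Nonempty (MonoidalClosed Man) := by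
  rintro ⟨_⟩
  -- The name of the zero function; the index `0` is an arbitrary choice.
  let x : (ihom (euclidean 1)).obj (euclidean 1) :=
    (MonoidalClosed.curry (euclidean 1 ◁ zeroHom 0 ≫ polyHom 0)).toFun ()
  obtain ⟨c, hc, hxc⟩ := Man.cover _ x
  -- One more coefficient than the chart at `x` has dimensions.
  let k := c.1 + 1
  let g := MonoidalClosed.curry (polyHom k)
  have hgx : g.toFun (0 : EuclideanSpace ℝ (Fin k)) = x := by
    -- Naturality of currying along the origin identifies `g 0` with the name of the zero function.
    have := MonoidalClosed.curry_natural_left (zeroHom k) (polyHom k)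
    rw [whiskerLeft_zeroHom_comp_polyHom, ← whiskerLeft_zeroHom_comp_polyHom 0] at this
    exact (congrArg (fun f : Hom point _ => f.toFun ()) this).symm
  let ev : Hom (Man.prod (euclidean 1) ((ihom (euclidean 1)).obj (euclidean 1))) (euclidean 1) :=
    (ihom.ev (euclidean 1)).app (euclidean 1)
  refine absurd (le_dim_of_comp_eq_polyFamily g.smooth (h := fun t y => ev.toFun (t, y))
    (fun t => ev.smooth.comp (IsSmooth.prodMk (M := euclidean 1) (isSmooth_const (N := euclidean 1) t)
      (isSmooth_id _))) (fun t a => ?_) hc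
    (by rwa [hgx])) (Nat.not_succ_le_self c.1)
  have := MonoidalClosed.uncurry_curry (polyHom k)
  rw [MonoidalClosed.uncurry_eq] at this
  exact congrArg (fun f : Hom (Man.prod (euclidean 1) (euclidean k)) _ => f.toFun (t, a)) this
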